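/- Notation. $\mathbb{C}_-$ is the open left half plane and $\mathbb{C}_+=(\mathbb{C}\setminus\mathbb{C}_-)\cup\{\infty\}$. $\mathbb{H}$ is the ring of proper rational functions with real coefficients all of whose poles lie in $\mathbb{C}_-$, and $\mathbb{J}$ is its group of units. Let $N_0,N_1,D_0,D_1\in\mathbb{H}^{m\times m}$, and for $\lambda\in[0,1]$ put $$N_\lambda=\lambda N_1+(1-\lambda)N_0,\qquad D_\lambda=\lambda D_1+(1-\lambda)D_0,\qquad P_\lambda=N_\lambda D_\lambda^{-1}.$$ Suppose that for every $\lambda\in[0,1]$ this is a right coprime representation, i.e. $\det D_\lambda\not\equiv 0$ and $XN_\lambda+YD_\lambda=I$ for some $X,Y\in\mathbb{H}^{m\times m}$. Let $$M=\begin{bmatrix}N_0&N_1\\ D_0&D_1\end{bmatrix},$$ and suppose that $\det M(\infty)\neq 0$ and that all zeros of $\det M$ in $\mathbb{C}_+$ are simple. A compensator $K$ (an $m\times m$ matrix of real rational functions) stabilizes a plant $P$ if $\det(I+KP)\not\equiv 0$ and the four closed-loop transfer matrices $(I+KP)^{-1}$, $P(I+KP)^{-1}$, $(I+KP)^{-1}K$,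 $(I+PK)^{-1}$ all have entries in $\mathbb{H}$. Proposition. There is a single proper $m\times m$ compensator $K$ that stabilizes $P_\lambda$ for all $\lambda\in[0,1]$ if and only if there exist $\Delta_0,\Delta_1\in\mathbb{H}^{m\times m}$ with $\det\Delta_0,\det\Delta_1\in\mathbb{J}$ such that (i) $\begin{bmatrix}\Delta_0&\Delta_1\end{bmatrix}\operatorname{Adj}(M)=0$ at every zero of $\det M$ in $\mathbb{C}_+$, where $\operatorname{Adj}$ is the adjugate, and (ii) for every $s\in\mathbb{C}_+$ (including $s=\infty$), no eigenvalue of $\Delta_0(s)^{-1}\Delta_1(s)$ lies on the nonpositive real axis or equals infinity (infinity counting as an eigenvalue when $\Delta_0(s)$ is singular). -/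

import Mathlib

noncomputable section

namespace SimStab

open Polynomial OnePoint

/-! ### The ring of proper stable rational functions -/

/-- A real rational function is proper if its numerator degree does not exceed its
denominator degree. -/
def IsProper (f : RatFunc ℝ) : Prop :=
  f.num.natDegree ≤ f.denom.natDegree

/-- All complex poles of `f` lie in the open left half plane. -/
def HasStablePoles (f : RatFunc ℝ) : Prop :=
  ∀ s : ℂ, aeval s f.denom = 0 → s.re < 0

/-- Properness and stability can be read off any fraction representing `f`. -/
theorem proper_stable_of_cross {f : RatFunc ℝ} {p q : ℝ[X]} (hq : q ≠ 0)
    (hdeg : p.natDegree ≤ q.natDegree) (hroot : ∀ s : ℂ, aeval s q = 0 → s.re < 0)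
    (hcross : f.num * q = p * f.denom) : IsProper f ∧ HasStablePoles f := by
  have hdvd : f.denom ∣ q :=
    (RatFunc.denom_dvd hq).2 ⟨p, (RatFunc.num_mul_eq_mul_denom_iff hq).1 hcross⟩
  refine ⟨?_, fun s hs => ?_⟩
  · unfold IsProper
    by_cases hn : f.num = 0
    · simp [hn]
    have hd := f.denom_ne_zero
    have hp : p ≠ 0 := by
      rintro rfl
      rw [zero_mul] at hcross
      exact (mul_ne_zero hn hq) hcross
    have h := congrArg natDegree hcross
    rw [natDegree_mul hn hq, natDegree_mul hp hd] at h
    omega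
  · obtain ⟨r, hr⟩ := hdvd
    apply hroot
    rw [hr, map_mul, hs, zero_mul]

/-- The ring `ℍ` of proper real rational functions all of whose poles lie in the open left
half plane, as a subalgebra of `ℝ(s)`. -/
def H : Subalgebra ℝ (RatFunc ℝ) where
  carrier := {f | IsProper f ∧ HasStablePoles f}
  mul_mem' := by
    rintro f g ⟨hf, hf'⟩ ⟨hg, hg'⟩
    refine proper_stable_of_cross (mul_ne_zero f.denom_ne_zero g.denom_ne_zero) ?_ ?_
      (RatFunc.num_denom_mul f g)
    · unfold IsProper at hf hg
      rw [natDegree_mul f.denom_ne_zero g.denom_ne_zero]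
      exact natDegree_mul_le.trans (add_le_add hf hg)
    · intro s hs
      rw [map_mul] at hs
      exact (mul_eq_zero.1 hs).elim (hf' s) (hg' s)
  add_mem' := by
    rintro f g ⟨hf, hf'⟩ ⟨hg, hg'⟩
    refine proper_stable_of_cross (mul_ne_zero f.denom_ne_zero g.denom_ne_zero) ?_ ?_
      (RatFunc.num_denom_add f g)
    · unfold IsProper at hf hg
      rw [natDegree_mul f.denom_ne_zero g.denom_ne_zero]
      refine (natDegree_add_le _ _).trans (max_le ?_ ?_)
      · exact natDegree_mul_le.trans (add_le_add hf le_rfl)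
      · exact natDegree_mul_le.trans (add_le_add le_rfl hg)
    · intro s hs
      rw [map_mul] at hs
      exact (mul_eq_zero.1 hs).elim (hf' s) (hg' s)
  algebraMap_mem' := by
    intro c
    refine proper_stable_of_cross (p := C c) (q := 1) one_ne_zero (by simp) (by simp) ?_
    rw [RatFunc.num_mul_eq_mul_denom_iff one_ne_zero]
    simp [RatFunc.algebraMap_C]

/-! ### Evaluation on the extended closed right half plane -/

/-- `ℂ₊ = (ℂ \ ℂ₋) ∪ {∞}`, where `ℂ₋` is the open left half plane. -/
def Cplus : Set (OnePoint ℂ) := {z | z = ∞ ∨ ∃ s : ℂ, 0 ≤ s.re ∧ z = (s : OnePoint ℂ)}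

/-- The value of a proper real rational function at infinity: the quotient of the
coefficients of `s ^ d`, where `d` is the degree of the denominator. -/
def evalInfty (f : RatFunc ℝ) : ℝ :=
  f.num.coeff f.denom.natDegree / f.denom.coeff f.denom.natDegree

/-- The value of an element of `ℍ` at a point of the Riemann sphere (meaningful on `ℂ₊`). -/
def evalAt (z : OnePoint ℂ) (f : H) : ℂ :=
  z.elim ((evalInfty f.1 : ℝ) : ℂ) (fun s => RatFunc.eval (algebraMap ℝ ℂ) s f.1)

/-- `f` has a simple zero at the finite point `s`: the reduced numerator does. -/
def IsSimpleZero (f : H) (s : ℂ) : Prop :=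
  (f.1.num.map (algebraMap ℝ ℂ)).rootMultiplicity s = 1

variable {m : ℕ}

/-- Square matrices over `ℍ`. -/
abbrev HMat (m : ℕ) := Matrix (Fin m) (Fin m) H

/-- Square matrices of real rational functions. -/
abbrev RMat (m : ℕ) := Matrix (Fin m) (Fin m) (RatFunc ℝ)

/-- A matrix over `ℍ` regarded as a matrix of rational functions. -/
def toRat (A : HMat m) : RMat m := A.map (fun f => (f : RatFunc ℝ))

/-- All entries proper. -/
def IsProperMat (A : RMat m) : Prop := ∀ i j, IsProper (A i j)

/-- All entries proper with poles in the open left half plane. -/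
def IsStableMat (A : RMat m) : Prop := ∀ i j, A i j ∈ H

/-! ### Plants, compensators and stabilization -/

/-- The convex combination `A_λ = λ A₁ + (1 - λ) A₀`. -/
def interp (A₀ A₁ : HMat m) (l : ℝ) : HMat m := l • A₁ + (1 - l) • A₀

/-- The plant `N D⁻¹`. -/
def plant (N D : HMat m) : RMat m := toRat N * (toRat D)⁻¹

/-- `N D⁻¹` is a right coprime representation over `ℍ`: `D` is invertible as a matrix of
rational functions and a Bezout identity `X N + Y D = 1` holds over `ℍ`. -/
def IsRightCoprimeRep (N D : HMat m) : Prop :=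
  D.det ≠ 0 ∧ ∃ X Y : HMat m, X * N + Y * D = 1

/-- `K` (internally) stabilizes `P`: the negative feedback loop of `P` and `K` is well posed
and its four closed-loop transfer matrices are proper and stable. -/
def Stabilizes (K P : RMat m) : Prop :=
  (1 + K * P).det ≠ 0 ∧
  IsStableMat ((1 + K * P)⁻¹) ∧
  IsStableMat (P * (1 + K * P)⁻¹) ∧
  IsStableMat ((1 + K * P)⁻¹ * K) ∧
  IsStableMat ((1 + P * K)⁻¹)

/-! ### The interpolation and eigenvalue conditions -/

/-- The block matrix `[N₀ N₁; D₀ D₁]`. -/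
def bigM (N₀ N₁ D₀ D₁ : HMat m) : Matrix (Fin m ⊕ Fin m) (Fin m ⊕ Fin m) H :=
  Matrix.fromBlocks N₀ N₁ D₀ D₁

/-- `[Δ₀ Δ₁] Adj(M)` vanishes at every zero of `det M` in `ℂ₊`. -/
def InterpolationCondition (M : Matrix (Fin m ⊕ Fin m) (Fin m ⊕ Fin m) H)
    (Δ₀ Δ₁ : HMat m) : Prop :=
  ∀ z ∈ Cplus, evalAt z M.det = 0 →
    (Matrix.fromCols Δ₀ Δ₁ * M.adjugate).map (evalAt z) = 0

/-- `μ` in the Riemann sphere is an eigenvalue of `A⁻¹ B`; the value `∞` occurs when `A` is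
singular. -/
def IsExtEigenvalue (A B : Matrix (Fin m) (Fin m) ℂ) (μ : OnePoint ℂ) : Prop :=
  μ.elim (A.det = 0) (fun α => Module.End.HasEigenvalue (Matrix.toLin' (A⁻¹ * B)) α)

/-- The nonpositive real axis including infinity. -/
def nonposAxis : Set (OnePoint ℂ) :=
  {μ | μ = ∞ ∨ ∃ x : ℝ, x ≤ 0 ∧ μ = ((x : ℂ) : OnePoint ℂ)}

/-- At no point of `ℂ₊` does `Δ₀⁻¹ Δ₁` have an eigenvalue in the nonpositive real axis
including infinity. -/
def EigenvalueCondition (Δ₀ Δ₁ : HMat m) : Prop :=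
  ∀ z ∈ Cplus, ∀ μ ∈ nonposAxis,
    ¬ IsExtEigenvalue (Δ₀.map (evalAt z)) (Δ₁.map (evalAt z)) μ

end SimStab

end

open SimStab

/-!
The proof is the factorization approach to stabilization. If `K` stabilizes `P₀ = N₀ D₀⁻¹`, then
`K = V⁻¹ U` with `V = (D₀ + K N₀)⁻¹` and `U = V K`, and the Bezout identity for `(N₀, D₀)` puts `U`
and `V` over `ℍ` (`Stabilizes.exists_factorization`). Conversely `V⁻¹ U` stabilizes `N D⁻¹` whenever
`U N + V D` is unimodular (`stabilizes_of_isUnit_det`). With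
`Δ₀ = U N₀ + V D₀` and `Δ₁ = U N₁ + V D₁`, that is `[Δ₀ Δ₁] = [U V] M`, the matrix
`U N_l + V D_l` is the convex combination `l Δ₁ + (1 - l) Δ₀`. So `K` stabilizes all `P_l` exactly
when the whole segment from `Δ₀` to `Δ₁` is unimodular.

The two conditions translate this into statements about `Δ₀`, `Δ₁` alone.

* `[Δ₀ Δ₁] = [U V] M` is solvable over `ℍ` if `[Δ₀ Δ₁] Adj(M)` vanishes at the zeros of `det M` in
  `ℂ₊`: none of these is at infinity and all are simple, so `det M` divides
  `[Δ₀ Δ₁] Adj(M)` (`InterpolationCondition.exists_eq`, by `dvd_of_simple_zeros`).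
* An element of `ℍ` is a unit iff it has no zero in `ℂ₊` (`isUnit_iff_evalHom_ne_zero`), and
  `l Δ₁ + (1 - l) Δ₀` is singular at a point iff `-(1 - l) / l` is an eigenvalue of `Δ₀⁻¹ Δ₁` there,
  which covers the nonpositive real axis with `∞` as `l` runs over `[0, 1]`
  (`eigenvalueCondition_iff`).

The solution `V` may be singular at infinity, and then `V⁻¹ U` need not be proper. Replacing `V` by
`V + ε` for a small `ε ≠ 0` repairs this: it makes `V(∞)` invertible, and since `[0, 1] × ℂ₊` is
compact, the perturbed segment stays unimodular (`eventually_isUnit_det_interp_add`).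
-/

noncomputable section

namespace SimStab

open scoped OnePoint
open Polynomial Filter Topology Matrix

/-! ### Evaluation of stable functions on the extended closed right half plane -/

theorem aeval_denom_ne_zero (f : H) {s : ℂ} (hs : 0 ≤ s.re) : aeval s f.1.denom ≠ 0 :=
  fun h => absurd (f.2.2 s h) (not_lt.2 hs)

theorem evalAt_coe (f : H) (s : ℂ) :
    evalAt (s : OnePoint ℂ) f = aeval s f.1.num / aeval s f.1.denom := rfl

theorem evalAt_coe_eq_zero_iff (f : H) {s : ℂ} (hs : 0 ≤ s.re) :
    evalAt (s : OnePoint ℂ) f = 0 ↔ aeval s f.1.num = 0 := by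
  rw [evalAt_coe, div_eq_zero_iff, or_iff_left (aeval_denom_ne_zero f hs)]

/-- After the substitution `s ↦ s⁻¹` a proper fraction becomes a quotient of two polynomials
that is regular at the origin, with value `evalInfty` there. -/
theorem tendsto_evalAt_infty (f : H) :
    Tendsto (fun s : ℂ => evalAt (s : OnePoint ℂ) f) (Bornology.cobounded ℂ)
      (𝓝 (evalAt ∞ f)) := by
  set d := f.1.denom.natDegree with hd
  have key (p : ℝ[X]) : Tendsto (fun s : ℂ => aeval s⁻¹ (reflect d p)) (Bornology.cobounded ℂ)
      (𝓝 ((p.coeff d : ℝ) : ℂ)) := by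
    have h0 : aeval (0 : ℂ) (reflect d p) = ((p.coeff d : ℝ) : ℂ) := by
      rw [← coeff_zero_eq_aeval_zero', coeff_reflect, revAt_zero]
      rfl
    rw [← h0]
    exact ((reflect d p).continuous_aeval.tendsto 0).comp tendsto_inv₀_cobounded
  have hlim := (key f.1.num).div (key f.1.denom)
    (by simpa [hd] using f.1.denom_ne_zero)
  have hval : evalAt ∞ f = ((f.1.num.coeff d : ℝ) : ℂ) / ((f.1.denom.coeff d : ℝ) : ℂ) :=
    Complex.ofReal_div _ _
  rw [hval]
  refine hlim.congr' ?_
  filter_upwards [Bornology.eventually_ne_cobounded (0 : ℂ)] with s hs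
  let := invertibleOfNonzero hs
  have hr (p : ℝ[X]) (hp : p.natDegree ≤ d) :
      aeval s p = aeval s⁻¹ (reflect d p) * s ^ d := by
    simpa [aeval_def] using (eval₂_reflect_mul_pow (algebraMap ℝ ℂ) s d p hp).symm
  rw [evalAt_coe, hr _ f.2.1, hr _ le_rfl]
  exact (mul_div_mul_right _ _ (pow_ne_zero _ hs)).symm

/-- Pointwise identities on the closed right half plane persist at infinity, by passing to the
limit along the positive real axis. -/
theorem evalAt_infty_eq_of_tendsto {f : H} {c : ℂ} {g : ℂ → ℂ}
    (hg : Tendsto g (Bornology.cobounded ℂ) (𝓝 c))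
    (h : ∀ s : ℂ, 0 ≤ s.re → evalAt (s : OnePoint ℂ) f = g s) : evalAt ∞ f = c := by
  have hR : Tendsto (fun x : ℝ => (x : ℂ)) atTop (Bornology.cobounded ℂ) :=
    tendsto_norm_atTop_iff_cobounded.1 (by simpa using tendsto_abs_atTop_atTop)
  refine tendsto_nhds_unique ((tendsto_evalAt_infty f).comp hR) ((hg.comp hR).congr' ?_)
  filter_upwards [eventually_ge_atTop 0] with x hx
  exact (h x (by simpa using hx)).symm

/-- Evaluation at a point of `ℂ₊` is a homomorphism of real algebras. -/
def evalHom (z : Cplus) : H →ₐ[ℝ] ℂ :=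
  AlgHom.ofLinearMap
    { toFun := evalAt z.1
      map_add' := by
        have hfin (f g : H) (s : ℂ) (hs : 0 ≤ s.re) :
            evalAt (s : OnePoint ℂ) (f + g) = evalAt s f + evalAt s g :=
          RatFunc.eval_add _ _ (aeval_denom_ne_zero f hs) (aeval_denom_ne_zero g hs)
        intro f g
        obtain ⟨z, rfl | ⟨s, hs, rfl⟩⟩ := z
        · exact evalAt_infty_eq_of_tendsto
            ((tendsto_evalAt_infty f).add (tendsto_evalAt_infty g)) (hfin f g)
        · exact hfin f g s hs
      map_smul' := by
        have hfin (c : ℝ) (f : H) (s : ℂ) (hs : 0 ≤ s.re) :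
            evalAt (s : OnePoint ℂ) (c • f) = c * evalAt s f := by
          have h : ((c • f : H) : RatFunc ℝ) = RatFunc.C c * f.1 := by
            rw [← RatFunc.smul_eq_C_mul]; rfl
          have := RatFunc.eval_mul (algebraMap ℝ ℂ) s (x := RatFunc.C c) (y := f.1)
            (by simp) (aeval_denom_ne_zero f hs)
          rw [← h, RatFunc.eval_C] at this
          exact this
        intro c f
        rw [RingHom.id_apply, Complex.real_smul]
        obtain ⟨z, rfl | ⟨s, hs, rfl⟩⟩ := z
        · exact evalAt_infty_eq_of_tendsto ((tendsto_evalAt_infty f).const_mul _) (hfin c f)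
        · exact hfin c f s hs }
    (by
      have hfin (s : ℂ) : evalAt (s : OnePoint ℂ) 1 = 1 := RatFunc.eval_one _ _
      obtain ⟨z, rfl | ⟨s, hs, rfl⟩⟩ := z
      · exact evalAt_infty_eq_of_tendsto tendsto_const_nhds fun s _ => hfin s
      · exact hfin s)
    (by
      have hfin (f g : H) (s : ℂ) (hs : 0 ≤ s.re) :
          evalAt (s : OnePoint ℂ) (f * g) = evalAt s f * evalAt s g :=
        RatFunc.eval_mul _ _ (aeval_denom_ne_zero f hs) (aeval_denom_ne_zero g hs)
      intro f g
      obtain ⟨z, rfl | ⟨s, hs, rfl⟩⟩ := z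
      · exact evalAt_infty_eq_of_tendsto
          ((tendsto_evalAt_infty f).mul (tendsto_evalAt_infty g)) (hfin f g)
      · exact hfin f g s hs)

theorem evalHom_apply (z : Cplus) (f : H) : evalHom z f = evalAt z.1 f := rfl

theorem isCompact_Cplus : IsCompact Cplus := by
  have h : Cplusᶜ = ((↑) : ℂ → OnePoint ℂ) '' {s | s.re < 0} := by
    ext z
    induction z using OnePoint.rec with
    | infty => simp [Cplus]
    | coe s => simp [Cplus]
  refine IsClosed.isCompact (isOpen_compl_iff.1 ?_)
  rw [h, OnePoint.isOpen_image_coe]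
  exact isOpen_lt Complex.continuous_re continuous_const

theorem continuous_evalHom (f : H) : Continuous fun z : Cplus => evalHom z f := by
  refine continuous_iff_continuousAt.2 fun z => ?_
  suffices h : ContinuousAt (fun z => evalAt z f) z.1 from
    h.comp continuous_subtype_val.continuousAt
  obtain ⟨z, rfl | ⟨s, hs, rfl⟩⟩ := z
  · refine OnePoint.continuousAt_infty'.2 ?_
    rw [coclosedCompact_eq_cocompact, ← Metric.cobounded_eq_cocompact]
    exact tendsto_evalAt_infty f
  · exact OnePoint.continuousAt_coe.2
      (f.1.num.continuous_aeval.continuousAt.div f.1.denom.continuous_aeval.continuousAt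
        (aeval_denom_ne_zero f hs))

/-! ### Divisibility and units -/

theorem isProper_div {p q : ℝ[X]} (hq : q ≠ 0) (h : p.natDegree ≤ q.natDegree) :
    IsProper (algebraMap ℝ[X] (RatFunc ℝ) p / algebraMap ℝ[X] (RatFunc ℝ) q) := by
  have hcross := (RatFunc.num_mul_eq_mul_denom_iff hq).2
    (rfl : algebraMap ℝ[X] (RatFunc ℝ) p / algebraMap ℝ[X] (RatFunc ℝ) q = _)
  unfold IsProper
  set f := algebraMap ℝ[X] (RatFunc ℝ) p / algebraMap ℝ[X] (RatFunc ℝ) q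
  by_cases hn : f.num = 0
  · simp [hn]
  have hp : p ≠ 0 := by
    rintro rfl
    simp [hn, hq] at hcross
  have := congrArg natDegree hcross
  rw [natDegree_mul hn hq, natDegree_mul hp f.denom_ne_zero] at this
  omega

theorem IsProper.mul {f g : RatFunc ℝ} (hf : IsProper f) (hg : IsProper g) :
    IsProper (f * g) := by
  rw [← f.num_div_denom, ← g.num_div_denom, div_mul_div_comm, ← map_mul, ← map_mul]
  refine isProper_div (mul_ne_zero f.denom_ne_zero g.denom_ne_zero) ?_
  rw [natDegree_mul f.denom_ne_zero g.denom_ne_zero]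
  exact natDegree_mul_le.trans (add_le_add hf hg)

theorem natDegree_denom_le_of_evalAt_infty_ne_zero {f : H} (h : evalAt ∞ f ≠ 0) :
    f.1.denom.natDegree ≤ f.1.num.natDegree := by
  refine le_natDegree_of_ne_zero fun h0 => h ?_
  have : evalInfty f.1 = 0 := by rw [evalInfty, h0, zero_div]
  change ((evalInfty f.1 : ℝ) : ℂ) = 0
  rw [this, Complex.ofReal_zero]

theorem coe_ne_zero_of_evalAt_infty_ne_zero {f : H} (h : evalAt ∞ f ≠ 0) : f.1 ≠ 0 := by
  intro h0
  refine h ?_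
  rw [show f = 0 from Subtype.ext h0]
  exact map_zero (evalHom ⟨∞, Or.inl rfl⟩)

theorem isProper_inv {f : H} (h : evalAt ∞ f ≠ 0) : IsProper f.1⁻¹ := by
  rw [← f.1.num_div_denom, inv_div]
  exact isProper_div (RatFunc.num_ne_zero (coe_ne_zero_of_evalAt_infty_ne_zero h))
    (natDegree_denom_le_of_evalAt_infty_ne_zero h)

/-- If `d` does not vanish at infinity and every zero of `d` in the closed right half plane is
simple and also a zero of `g`, then `g / d` has no pole in `ℂ₊`. -/
theorem dvd_of_simple_zeros {d g : H} (hinf : evalAt ∞ d ≠ 0)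
    (h : ∀ s : ℂ, 0 ≤ s.re → evalAt (s : OnePoint ℂ) d = 0 →
      IsSimpleZero d s ∧ evalAt (s : OnePoint ℂ) g = 0) : d ∣ g := by
  have hd := coe_ne_zero_of_evalAt_infty_ne_zero hinf
  have hdn : d.1.num ≠ 0 := RatFunc.num_ne_zero hd
  suffices hs : HasStablePoles (g.1 * d.1⁻¹) by
    refine ⟨⟨g.1 * d.1⁻¹, IsProper.mul g.2.1 (isProper_inv hinf), hs⟩, Subtype.ext ?_⟩
    change g.1 = d.1 * (g.1 * d.1⁻¹)
    field_simp
  set q := g.1 * d.1⁻¹ with hq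
  have hcross : q.num * (g.1.denom * d.1.num) = g.1.num * d.1.denom * q.denom := by
    rw [RatFunc.num_mul_eq_mul_denom_iff (mul_ne_zero g.1.denom_ne_zero hdn), hq]
    nth_rw 1 [← g.1.num_div_denom, ← d.1.num_div_denom]
    rw [inv_div, div_mul_div_comm, ← map_mul, ← map_mul]
  intro s hs
  by_contra! hre
  have hgd := aeval_denom_ne_zero g hre
  have hdd := aeval_denom_ne_zero d hre
  -- A pole `s` of the quotient would be a zero of the numerator of `d`, hence of that of `g`.
  have hdvd : q.denom ∣ g.1.denom * d.1.num :=
    (RatFunc.isCoprime_num_denom q).symm.dvd_of_dvd_mul_left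
      ⟨g.1.num * d.1.denom, by rw [hcross, mul_comm]⟩
  have hdz : aeval s d.1.num = 0 := by
    obtain ⟨r, hr⟩ := hdvd
    have := congrArg (aeval s) hr
    rw [map_mul, map_mul, hs, zero_mul] at this
    exact (mul_eq_zero.1 this).resolve_left hgd
  obtain ⟨hsimple, hgz⟩ := h s hre ((evalAt_coe_eq_zero_iff d hre).2 hdz)
  rw [evalAt_coe_eq_zero_iff g hre] at hgz
  -- Then the numerator of the quotient vanishes at `s` too, by comparing orders in `hcross`.
  have hqz : aeval s q.num = 0 := by
    have root {p : ℝ[X]} (hp : aeval s p = 0) : X - C s ∣ p.map (algebraMap ℝ ℂ) :=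
      dvd_iff_isRoot.2 (by rwa [IsRoot, eval_map_algebraMap])
    have hmap := congrArg (Polynomial.map (algebraMap ℝ ℂ)) hcross
    simp only [Polynomial.map_mul] at hmap
    obtain ⟨a, ha⟩ := root hdz
    have ha0 : eval s a ≠ 0 := by
      intro h0
      obtain ⟨b, rfl⟩ := dvd_iff_isRoot.2 h0
      have hne : d.1.num.map (algebraMap ℝ ℂ) ≠ 0 :=
        (Polynomial.map_ne_zero_iff (algebraMap ℝ ℂ).injective).2 hdn
      have : 2 ≤ (d.1.num.map (algebraMap ℝ ℂ)).rootMultiplicity s :=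
        (le_rootMultiplicity_iff hne).2 ⟨b, by rw [ha]; ring⟩
      rw [IsSimpleZero] at hsimple
      omega
    obtain ⟨b, hb⟩ := root hgz
    obtain ⟨c, hc⟩ := root hs
    rw [ha, hb, hc] at hmap
    have := mul_left_cancel₀ (X_sub_C_ne_zero s)
      (show (X - C s) * (q.num.map (algebraMap ℝ ℂ) * (g.1.denom.map (algebraMap ℝ ℂ) * a)) =
        (X - C s) * (b * d.1.denom.map (algebraMap ℝ ℂ) * ((X - C s) * c)) by
          linear_combination hmap)
    have := congrArg (eval s) this
    simp only [eval_mul, eval_sub, eval_X, eval_C, sub_self, zero_mul, mul_zero, mul_eq_zero,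
      ha0, or_false, eval_map_algebraMap, hgd] at this
    exact this
  obtain ⟨u, v, huv⟩ := RatFunc.isCoprime_num_denom q
  have := congrArg (aeval s) huv
  simp [hqz, hs] at this

/-- The units of `ℍ` are the functions without zeros in `ℂ₊`. -/
theorem isUnit_iff_evalHom_ne_zero {f : H} : IsUnit f ↔ ∀ z : Cplus, evalHom z f ≠ 0 := by
  refine ⟨fun h z => (h.map (evalHom z)).ne_zero, fun h => isUnit_of_dvd_one ?_⟩
  exact dvd_of_simple_zeros (h ⟨∞, Or.inl rfl⟩)
    fun s hs h0 => absurd h0 (h ⟨s, Or.inr ⟨s, hs, rfl⟩⟩)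

/-! ### Convex combinations and the eigenvalue condition -/

variable {m : ℕ}

theorem map_evalHom_interp (z : Cplus) (A B : HMat m) (l : ℝ) :
    (evalHom z).mapMatrix (interp A B l) =
      l • (evalHom z).mapMatrix B + (1 - l) • (evalHom z).mapMatrix A := by
  rw [interp, map_add, map_smul, map_smul]

theorem evalHom_det (z : Cplus) (A : HMat m) :
    evalHom z A.det = ((evalHom z).mapMatrix A).det :=
  AlgHom.map_det _ _

/-- For invertible `A`, a finite eigenvalue of `A⁻¹ B` is a singular point of the pencil
`x A - B`. -/
theorem isExtEigenvalue_coe_iff {A B : Matrix (Fin m) (Fin m) ℂ} (hA : A.det ≠ 0) (x : ℂ) :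
    IsExtEigenvalue A B (x : OnePoint ℂ) ↔ (x • A - B).det = 0 := by
  change Module.End.HasEigenvalue (Matrix.toLin' (A⁻¹ * B)) x ↔ _
  have h : x • A - B = A * (scalar (Fin m) x - A⁻¹ * B) := by
    rw [mul_sub, mul_nonsing_inv_cancel_left _ _ hA.isUnit, scalar_apply, ← smul_one_eq_diagonal,
      Matrix.mul_smul, mul_one]
  rw [Module.End.hasEigenvalue_iff_isRoot_charpoly, Matrix.charpoly_toLin', IsRoot,
    Matrix.eval_charpoly, h, det_mul, mul_eq_zero, or_iff_right hA]

/-- The point `x = -(1 - l) / l` of the nonpositive real axis, with `x = ∞` for `l = 0`,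
corresponds to the convex combination with weight `l`. -/
theorem forall_not_isExtEigenvalue_iff (A B : Matrix (Fin m) (Fin m) ℂ) :
    (∀ μ ∈ nonposAxis, ¬ IsExtEigenvalue A B μ) ↔
      ∀ l ∈ Set.Icc (0 : ℝ) 1, (l • B + (1 - l) • A).det ≠ 0 := by
  constructor
  · intro h l ⟨hl0, hl1⟩
    have hA : A.det ≠ 0 := h ∞ (Or.inl rfl)
    obtain rfl | hl := hl0.eq_or_lt
    · simpa using hA
    have hx := h _ (Or.inr ⟨-((1 - l) / l), by
      simpa using div_nonneg (sub_nonneg.2 hl1) hl0, rfl⟩)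
    rw [isExtEigenvalue_coe_iff hA] at hx
    have hlC : (l : ℂ) ≠ 0 := by exact_mod_cast hl.ne'
    have e : l • B + (1 - l) • A = (-(l : ℂ)) • ((((-((1 - l) / l) : ℝ) : ℂ)) • A - B) := by
      ext i j
      simp only [Matrix.add_apply, Matrix.smul_apply, Matrix.sub_apply, Complex.real_smul,
        smul_eq_mul]
      push_cast
      field_simp
      ring
    rw [e, det_smul]
    exact mul_ne_zero (pow_ne_zero _ (neg_ne_zero.2 hlC)) hx
  · intro h
    have hA : A.det ≠ 0 := by simpa using h 0 (by simp)
    rintro μ (rfl | ⟨x, hx, rfl⟩)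
    · exact hA
    rw [isExtEigenvalue_coe_iff hA]
    intro h0
    have hpos : 0 < 1 - x := by linarith
    have hC : (1 - x : ℂ) ≠ 0 := by exact_mod_cast hpos.ne'
    refine h (1 / (1 - x)) ⟨by positivity, by rw [div_le_one hpos]; linarith⟩ ?_
    have e : (1 / (1 - x)) • B + (1 - 1 / (1 - x)) • A =
        (-(1 / (1 - x) : ℂ)) • ((x : ℂ) • A - B) := by
      ext i j
      simp only [Matrix.add_apply, Matrix.smul_apply, Matrix.sub_apply, Complex.real_smul,
        smul_eq_mul]
      push_cast
      field_simp
      ring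
    rw [e, det_smul, h0, mul_zero]

theorem eigenvalueCondition_iff (Δ₀ Δ₁ : HMat m) :
    EigenvalueCondition Δ₀ Δ₁ ↔ ∀ l ∈ Set.Icc (0 : ℝ) 1, IsUnit (interp Δ₀ Δ₁ l).det := by
  have h (z : OnePoint ℂ) (hz : z ∈ Cplus) :=
    forall_not_isExtEigenvalue_iff (Δ₀.map (evalAt z)) (Δ₁.map (evalAt z))
  constructor
  · intro hE l hl
    refine isUnit_iff_evalHom_ne_zero.2 fun z => ?_
    rw [evalHom_det, map_evalHom_interp]
    exact (h z.1 z.2).1 (hE z.1 z.2) l hl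
  · intro hU z hz
    refine (h z hz).2 fun l hl => ?_
    have := isUnit_iff_evalHom_ne_zero.1 (hU l hl) ⟨z, hz⟩
    rwa [evalHom_det, map_evalHom_interp] at this

/-- Unimodularity of a whole segment of matrices survives small perturbations, because the
determinant is continuous and `[0, 1] × ℂ₊` is compact. -/
theorem eventually_isUnit_det_interp_add {Δ₀ Δ₁ : HMat m} (E₀ E₁ : HMat m)
    (h : ∀ l ∈ Set.Icc (0 : ℝ) 1, IsUnit (interp Δ₀ Δ₁ l).det) :
    ∀ᶠ ε : ℝ in 𝓝 0, ∀ l ∈ Set.Icc (0 : ℝ) 1,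
      IsUnit (interp Δ₀ Δ₁ l + ε • interp E₀ E₁ l).det := by
  have : CompactSpace Cplus := isCompact_iff_compactSpace.1 isCompact_Cplus
  let F : ℝ × ℝ × Cplus → ℂ := fun p =>
    ((evalHom p.2.2).mapMatrix (interp Δ₀ Δ₁ p.2.1 + p.1 • interp E₀ E₁ p.2.1)).det
  have hm (A : HMat m) : Continuous fun p : ℝ × ℝ × Cplus => (evalHom p.2.2).mapMatrix A :=
    continuous_matrix fun i j => (continuous_evalHom (A i j)).comp (by fun_prop)
  have hF : Continuous F := by
    refine Continuous.matrix_det ?_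
    simp only [map_add, map_smul, map_evalHom_interp]
    have h0 := hm Δ₀
    have h1 := hm Δ₁
    have h2 := hm E₀
    have h3 := hm E₁
    fun_prop
  have hK : IsCompact (Set.Icc (0 : ℝ) 1 ×ˢ (Set.univ : Set Cplus)) :=
    isCompact_Icc.prod isCompact_univ
  have := hK.eventually_forall_of_forall_eventually (x₀ := (0 : ℝ))
    (P := fun ε y => F (ε, y) ≠ 0) fun y hy => by
      refine hF.continuousAt.eventually_ne ?_
      have := isUnit_iff_evalHom_ne_zero.1 (h y.1 hy.1) y.2
      rw [evalHom_det] at this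
      simpa only [F, zero_smul, add_zero] using this
  filter_upwards [this] with ε hε l hl
  refine isUnit_iff_evalHom_ne_zero.2 fun z => ?_
  rw [evalHom_det]
  exact hε (l, z) ⟨hl, Set.mem_univ _⟩

/-- Only the finitely many `ε` for which `-ε` is an eigenvalue of `V(z)` make `V(z) + ε`
singular. -/
theorem eventually_evalHom_det_add_smul_one_ne_zero (z : Cplus) (V : HMat m) :
    ∀ᶠ ε : ℝ in 𝓝[≠] 0, evalHom z (V + ε • 1).det ≠ 0 := by
  set A := (evalHom z).mapMatrix V
  have hfin : ∀ᶠ x : ℂ in cofinite, x ∉ (-A).charpoly.rootSet ℂ :=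
    (rootSet_finite _ ℂ).compl_mem_cofinite
  have hR : ∀ᶠ ε : ℝ in cofinite, (ε : ℂ) ∉ (-A).charpoly.rootSet ℂ :=
    Complex.ofReal_injective.tendsto_cofinite.eventually hfin
  filter_upwards [nhdsNE_le_cofinite (0 : ℝ) hR] with ε hε h0
  refine hε ((mem_rootSet_of_ne (charpoly_monic _).ne_zero).2 ?_)
  rw [coe_aeval_eq_eval, Matrix.eval_charpoly, sub_neg_eq_add, add_comm, scalar_apply,
    ← smul_one_eq_diagonal]
  rw [evalHom_det, map_add, map_smul, map_one] at h0
  exact h0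

/-! ### Coprime factorizations of a compensator -/

theorem toRat_mul (A B : HMat m) : toRat (A * B) = toRat A * toRat B :=
  map_mul H.val.mapMatrix A B

theorem toRat_add (A B : HMat m) : toRat (A + B) = toRat A + toRat B :=
  map_add H.val.mapMatrix A B

theorem toRat_one : toRat (1 : HMat m) = 1 := map_one H.val.mapMatrix

theorem det_toRat (A : HMat m) : (toRat A).det = A.det.1 := (AlgHom.map_det H.val A).symm

theorem toRat_injective : Function.Injective (toRat (m := m)) :=
  Matrix.map_injective Subtype.val_injective

theorem isUnit_det_toRat {A : HMat m} (h : A.det ≠ 0) : IsUnit (toRat A).det := by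
  rw [det_toRat]
  exact (Subtype.coe_ne_coe.2 h).isUnit

theorem isStableMat_iff {A : RMat m} : IsStableMat A ↔ ∃ B : HMat m, toRat B = A :=
  ⟨fun h => ⟨fun i j => ⟨A i j, h i j⟩, rfl⟩, by rintro ⟨B, rfl⟩ i j; exact (B i j).2⟩

theorem isProperMat_inv_mul {U V : HMat m} (hV : evalAt ∞ V.det ≠ 0) :
    IsProperMat ((toRat V)⁻¹ * toRat U) := by
  intro i j
  have h : ((toRat V)⁻¹ * toRat U) i j = V.det.1⁻¹ * (toRat (V.adjugate * U) i j) := by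
    rw [Matrix.inv_def, Matrix.smul_mul, Matrix.smul_apply, smul_eq_mul, Ring.inverse_eq_inv',
      det_toRat, toRat_mul]
    exact congrArg (fun A => _ * (A * toRat U) i j) (AlgHom.map_adjugate H.val V).symm
  rw [h]
  exact IsProper.mul (isProper_inv hV) ((V.adjugate * U) i j).2.1

theorem toRat_sub (A B : HMat m) : toRat (A - B) = toRat A - toRat B :=
  map_sub H.val.mapMatrix A B

theorem inv_one_add_mul_comm {K P : RMat m} (h : (1 + K * P).det ≠ 0) :
    (1 + P * K)⁻¹ = 1 - P * ((1 + K * P)⁻¹ * K) := by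
  have hS := mul_nonsing_inv _ h.isUnit
  set S := (1 + K * P)⁻¹
  refine inv_eq_right_inv ?_
  calc (1 + P * K) * (1 - P * (S * K)) = 1 + P * K - P * ((1 + K * P) * S) * K := by noncomm_ring
    _ = 1 := by rw [hS, mul_one, add_sub_cancel_right]

/-- The compensator `V⁻¹ U` stabilizes `N D⁻¹` as soon as `U N + V D` is unimodular: the four
closed-loop matrices are `D W V`, `N W V`, `D W U` and `1 - N W U`, where `W` is the inverse of
`U N + V D`. -/
theorem stabilizes_of_isUnit_det {U V N D : HMat m} (hV : V.det ≠ 0) (hD : D.det ≠ 0)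
    (h : IsUnit (U * N + V * D).det) :
    Stabilizes ((toRat V)⁻¹ * toRat U) (plant N D) := by
  obtain ⟨W, hW⟩ := ((Matrix.isUnit_iff_isUnit_det _).2 h).exists_left_inv
  have hW' : W * (U * N + V * D) = 1 := hW
  have hV' := isUnit_det_toRat hV
  have hD' := isUnit_det_toRat hD
  set K := (toRat V)⁻¹ * toRat U
  set P := plant N D
  have hVK : toRat V * K = toRat U := mul_nonsing_inv_cancel_left _ _ hV'
  have hPD : P * toRat D = toRat N := nonsing_inv_mul_cancel_right _ _ hD'
  have hWR : toRat W * (toRat U * toRat N + toRat V * toRat D) = 1 := by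
    rw [← toRat_mul, ← toRat_mul, ← toRat_add, ← toRat_mul, hW', toRat_one]
  have hfac : toRat V * (1 + K * P) * toRat D = toRat U * toRat N + toRat V * toRat D := by
    rw [← hVK, ← hPD]
    noncomm_ring
  have hR : toRat D * toRat W * toRat V * (1 + K * P) = 1 := by
    have h1 : (toRat W * toRat V * (1 + K * P)) * toRat D = 1 := by
      rw [← hfac] at hWR
      simpa only [mul_assoc] using hWR
    simpa only [mul_assoc] using mul_eq_one_comm.1 h1
  have hdet : (1 + K * P).det ≠ 0 := det_ne_zero_of_left_inverse hR
  rw [Stabilizes, inv_one_add_mul_comm hdet, inv_eq_left_inv hR]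
  refine ⟨hdet, isStableMat_iff.2 ⟨D * W * V, ?_⟩, isStableMat_iff.2 ⟨N * W * V, ?_⟩,
    isStableMat_iff.2 ⟨D * W * U, ?_⟩, isStableMat_iff.2 ⟨1 - N * W * U, ?_⟩⟩ <;>
  simp only [toRat_sub, toRat_one, toRat_mul, ← hVK, ← hPD, mul_assoc]

/-- A compensator `K` stabilizing a right coprime plant `N D⁻¹` has the left factorization
`K = Q⁻¹ R` over `ℍ` with `Q = (D + K N)⁻¹` and `R = Q K`. -/
theorem Stabilizes.exists_factorization {K : RMat m} {N D : HMat m}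
    (hc : IsRightCoprimeRep N D) (h : Stabilizes K (plant N D)) :
    ∃ R Q : HMat m, toRat Q * (toRat D + K * toRat N) = 1 ∧ toRat Q * K = toRat R := by
  obtain ⟨hD, X, Y, hXY⟩ := hc
  obtain ⟨hdet, h1, h2, h3, h4⟩ := h
  rw [inv_one_add_mul_comm hdet] at h4
  obtain ⟨A₁, hA₁⟩ := isStableMat_iff.1 h1
  obtain ⟨A₂, hA₂⟩ := isStableMat_iff.1 h2
  obtain ⟨A₃, hA₃⟩ := isStableMat_iff.1 h3
  obtain ⟨A₄, hA₄⟩ := isStableMat_iff.1 h4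
  have hD' := isUnit_det_toRat hD
  have hSinv := nonsing_inv_mul _ hdet.isUnit
  have hPD : plant N D * toRat D = toRat N := nonsing_inv_mul_cancel_right _ _ hD'
  set P := plant N D
  set S := (1 + K * P)⁻¹
  have hDD : toRat D * (toRat D)⁻¹ = 1 := mul_nonsing_inv _ hD'
  have hbez : (toRat X * P + toRat Y) * toRat D = 1 := by
    rw [add_mul, mul_assoc, hPD, ← toRat_mul, ← toRat_mul, ← toRat_add, hXY, toRat_one]
  have hQ : toRat (X * A₂ + Y * A₁) = (toRat X * P + toRat Y) * S := by
    rw [toRat_add, toRat_mul, toRat_mul, hA₁, hA₂]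
    noncomm_ring
  refine ⟨X * (1 - A₄) + Y * A₃, X * A₂ + Y * A₁, ?_, ?_⟩
  · rw [hQ, ← hPD]
    calc (toRat X * P + toRat Y) * S * (toRat D + K * (P * toRat D))
        = (toRat X * P + toRat Y) * (S * (1 + K * P)) * toRat D := by noncomm_ring
      _ = 1 := by rw [hSinv, mul_one, hbez]
  · rw [hQ, toRat_add, toRat_mul, toRat_mul, toRat_sub, hA₃, hA₄, toRat_one]
    noncomm_ring

/-! ### The interpolation condition -/

theorem interp_mul_add_mul (U V A₀ A₁ B₀ B₁ : HMat m) (l : ℝ) :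
    interp (U * A₀ + V * B₀) (U * A₁ + V * B₁) l = U * interp A₀ A₁ l + V * interp B₀ B₁ l := by
  simp only [interp, mul_add, smul_add, Matrix.mul_smul]
  abel

theorem fromCols_mul_bigM (U V N₀ N₁ D₀ D₁ : HMat m) :
    fromCols U V * bigM N₀ N₁ D₀ D₁ = fromCols (U * N₀ + V * D₀) (U * N₁ + V * D₁) :=
  fromCols_mul_fromBlocks ..

theorem interpolationCondition_mul_add_mul (U V N₀ N₁ D₀ D₁ : HMat m) :
    InterpolationCondition (bigM N₀ N₁ D₀ D₁) (U * N₀ + V * D₀) (U * N₁ + V * D₁) := by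
  intro z hz h0
  rw [← fromCols_mul_bigM, Matrix.mul_assoc, mul_adjugate, Matrix.mul_smul, Matrix.mul_one]
  ext i j
  change evalHom ⟨z, hz⟩ (_ * _) = 0
  rw [map_mul, evalHom_apply, h0, zero_mul]

/-- Solvability of `[U V] M = [Δ₀ Δ₁]` over `ℍ`: the interpolation condition cancels the zeros of
`det M` in `[Δ₀ Δ₁] Adj(M) / det M`. -/
theorem InterpolationCondition.exists_eq {N₀ N₁ D₀ D₁ Δ₀ Δ₁ : HMat m}
    (hinf : evalAt ∞ (bigM N₀ N₁ D₀ D₁).det ≠ 0)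
    (hsimple : ∀ s : ℂ, 0 ≤ s.re → evalAt (s : OnePoint ℂ) (bigM N₀ N₁ D₀ D₁).det = 0 →
      IsSimpleZero (bigM N₀ N₁ D₀ D₁).det s)
    (h : InterpolationCondition (bigM N₀ N₁ D₀ D₁) Δ₀ Δ₁) :
    ∃ U V : HMat m, Δ₀ = U * N₀ + V * D₀ ∧ Δ₁ = U * N₁ + V * D₁ := by
  set M := bigM N₀ N₁ D₀ D₁ with hM
  have hdvd (i j) : M.det ∣ (fromCols Δ₀ Δ₁ * M.adjugate) i j :=
    dvd_of_simple_zeros hinf fun s hs h0 =>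
      ⟨hsimple s hs h0, congrFun (congrFun (h s (Or.inr ⟨s, hs, rfl⟩) h0) i) j⟩
  choose q hq using hdvd
  have hdet : M.det ≠ 0 := fun h0 =>
    coe_ne_zero_of_evalAt_infty_ne_zero hinf (congrArg Subtype.val h0)
  have hQ : M.det • Matrix.of q = fromCols Δ₀ Δ₁ * M.adjugate := by
    ext1 i j
    exact (hq i j).symm
  have hQM : Matrix.of q * M = fromCols Δ₀ Δ₁ := by
    refine smul_right_injective _ hdet ?_
    change M.det • _ = M.det • _
    rw [← Matrix.smul_mul, hQ, Matrix.mul_assoc, adjugate_mul, Matrix.mul_smul, Matrix.mul_one]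
  rw [← fromCols_toCols (Matrix.of q), hM, fromCols_mul_bigM, fromCols_ext_iff] at hQM
  exact ⟨_, _, hQM.1.symm, hQM.2.symm⟩

end SimStab

end

open SimStab
theorem proposition2 (m : ℕ) (N₀ N₁ D₀ D₁ : HMat m)
    (hP : ∀ l ∈ Set.Icc (0 : ℝ) 1,
      IsRightCoprimeRep (interp N₀ N₁ l) (interp D₀ D₁ l))
    (hinf : evalAt OnePoint.infty (bigM N₀ N₁ D₀ D₁).det ≠ 0)
    (hsimple : ∀ s : ℂ, 0 ≤ s.re → evalAt (s : OnePoint ℂ) (bigM N₀ N₁ D₀ D₁).det = 0 →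
      IsSimpleZero (bigM N₀ N₁ D₀ D₁).det s) :
    (∃ K : RMat m, IsProperMat K ∧
      ∀ l ∈ Set.Icc (0 : ℝ) 1,
        Stabilizes K (plant (interp N₀ N₁ l) (interp D₀ D₁ l))) ↔
    (∃ Δ₀ Δ₁ : HMat m, IsUnit Δ₀.det ∧ IsUnit Δ₁.det ∧
      InterpolationCondition (bigM N₀ N₁ D₀ D₁) Δ₀ Δ₁ ∧
      EigenvalueCondition Δ₀ Δ₁) := by
  constructor
  · rintro ⟨K, -, hK⟩
    have h0 : (0 : ℝ) ∈ Set.Icc (0 : ℝ) 1 := by simp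
    obtain ⟨R, Q, hQ, hR⟩ := (hK 0 h0).exists_factorization (hP 0 h0)
    have hunit (l : ℝ) (hl : l ∈ Set.Icc (0 : ℝ) 1) :
        IsUnit (interp (R * N₀ + Q * D₀) (R * N₁ + Q * D₁) l).det := by
      obtain ⟨R', Q', hQ', hR'⟩ := (hK l hl).exists_factorization (hP l hl)
      rw [interp_mul_add_mul]
      -- `Q (D_l + K N_l)` has the inverse `Q' (D₀ + K N₀)`, and both products lie over `ℍ`.
      refine Matrix.isUnit_det_of_left_inverse
        (B := Q' * interp D₀ D₁ 0 + R' * interp N₀ N₁ 0) (toRat_injective ?_)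
      simp only [toRat_mul, toRat_add, toRat_one, ← hR, ← hR']
      have hcomm := mul_eq_one_comm.1 hQ
      calc _ = toRat Q' * ((toRat (interp D₀ D₁ 0) + K * toRat (interp N₀ N₁ 0)) * toRat Q) *
            (toRat (interp D₀ D₁ l) + K * toRat (interp N₀ N₁ l)) := by noncomm_ring
        _ = 1 := by rw [hcomm, mul_one, hQ']
    refine ⟨_, _, by simpa [interp] using hunit 0 h0, by simpa [interp] using hunit 1 (by simp),
      interpolationCondition_mul_add_mul R Q N₀ N₁ D₀ D₁, (eigenvalueCondition_iff _ _).2 hunit⟩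
  · rintro ⟨Δ₀, Δ₁, -, -, hI, hE⟩
    obtain ⟨U, V, rfl, rfl⟩ := hI.exists_eq hinf hsimple
    -- `V` may be singular at infinity; replacing it by `V + ε` makes `V⁻¹ U` proper.
    obtain ⟨ε, hε, hVε⟩ := ((Filter.Eventually.filter_mono nhdsWithin_le_nhds
      (eventually_isUnit_det_interp_add D₀ D₁ ((eigenvalueCondition_iff _ _).1 hE))).and
      (eventually_evalHom_det_add_smul_one_ne_zero ⟨OnePoint.infty, Or.inl rfl⟩ V)).exists
    have hV : (V + ε • 1).det ≠ 0 := fun h => hVε (by rw [h, map_zero])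
    refine ⟨_, isProperMat_inv_mul (U := U) hVε, fun l hl =>
      stabilizes_of_isUnit_det hV (hP l hl).1 ?_⟩
    have := hε l hl
    rwa [interp_mul_add_mul, add_assoc, ← smul_one_mul, ← add_mul] at this
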